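/- Let $b_1<b_2<\dots<b_5$ be real, let $R(z)=-\prod_{k=1}^5(z-b_k)$, and let $G$ be the genus 2 curve $w^2=R(z)$ (completed by one point $\infty$). Suppose that $G$ is an $N$-fold hyperelliptic tangential covering of an elliptic curve $\mathcal E=\{y^2=4x^3-g_2x-g_3\}$: the covering maps $\infty\in G$ to the point at infinity of $\mathcal E$, and the image of $\mathcal E$ in $\mathrm{Jac}(G)$ is tangent at the origin to the image of $G$ under $P\mapsto\int_\infty^P\left(\frac{dz}{w},\frac{z\,dz}{w}\right)$. Let $$Z=\mathcal Z(z),\qquad W=w^k\,\mathcal W(z)\qquad(k\text{ odd},\ \mathcal Z,\mathcal W\text{ real rational functions},\ \mathcal Z(\infty)=\infty)$$ be the complementary $N$-fold covering of a second elliptic curve $\mathcal E_2=\{W^2=-(4Z^3-G_2Z-G_3)\}$ with real $G_2,G_3$; complementary means that the pullback of the holomorphic differential $dZ/W$ to $G$ vanishes on the image of $\mathcal E$ in $\mathrm{Jac}(G)$. Let $$S=\{(z_1,z_2)\in\mathbb R^2:\ b_2\le z_1\le b_3,\ b_4\le z_2\le b_5\},$$ and assume that $\mathcal Z(z_1)$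 and $\mathcal Z(z_2)$ are finite for all $(z_1,z_2)\in S$. For a real number $\tilde\wp_*=\tilde\wp(U_*)$, where $\tilde\wp$ is the Weierstrass function of $\mathcal E_2$ (so $Z=\tilde\wp(U)$, $W=\tilde\wp'(U)$), let the polhode $\mathcal H_{\tilde\wp_*}$ be the curve in the $(z_1,z_2)$-plane given, with $Z_i=\mathcal Z(z_i)$, by $$16(Z_2-Z_1)^2\tilde\wp_*^2+\left[16G_3+8G_2(Z_1+Z_2)-32Z_1Z_2(Z_1+Z_2)\right]\tilde\wp_*+16G_3(Z_1+Z_2)+8G_2Z_1Z_2+16Z_1^2Z_2^2+G_2^2=0,$$ and call its part lying in $S$ its real asymmetric part. If $\tilde\wp_*=\mathcal Z(z_1)$ or $\tilde\wp_*=\mathcal Z(z_2)$ for some $(z_1,z_2)\in S$, then the real asymmetric part of $\mathcal H_{\tilde\wp_*}$ is empty. -/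

import Mathlib

open Polynomial

noncomputable section

/-- The quintic `R(z) = -∏ (z - b_k)`, with coefficients in `K`; the genus 2 curve `G` is
`w² = R(z)` together with one point `∞`. The indices `0, …, 4` stand for `1, …, 5`. -/
def quintic (K : Type) [Field K] [Algebra ℝ K] (b : Fin 5 → ℝ) : K[X] :=
  -∏ i, (X - C (algebraMap ℝ K (b i)))

/-- The value at `z : ℂ` of a rational function with coefficients in `K ⊆ ℂ`. -/
def evalC {K : Type} [Field K] [Algebra K ℂ] (f : RatFunc K) (z : ℂ) : ℂ :=
  f.eval (algebraMap K ℂ) z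

/-- `(z, w) ↦ (x, y) = (Φ(z), w ^ k * Ψ(z))`, with `k` odd and `Φ`, `Ψ` rational functions over `K`,
is an `N`-fold covering of the elliptic curve `y² = ε (4 x³ - c₂ x - c₃)` by the curve
`G : w² = R(z)`, and it sends the point `∞` of `G` to the point at infinity.
(The degree of the covering is the degree of the rational function `Φ`, since both `z : G → ℙ¹` and
`x` on the elliptic curve have degree 2.) -/
structure IsEllipticCover {K : Type} [Field K] (R : K[X]) (N : ℕ) (ε c₂ c₃ : K) (k : ℕ)
    (Φ Ψ : RatFunc K) : Prop where
  odd : Odd k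
  nonsingular : c₂ ^ 3 - 27 * c₃ ^ 2 ≠ 0
  equation : (algebraMap K[X] (RatFunc K) R) ^ k * Ψ ^ 2 =
    RatFunc.C ε * (4 * Φ ^ 3 - RatFunc.C c₂ * Φ - RatFunc.C c₃)
  degree : max Φ.num.natDegree Φ.denom.natDegree = N
  infinity : Φ.denom.natDegree < Φ.num.natDegree

/-- The finite points `(z, w)` of `G : w² = R(z)` over the point `(x, y)` of the elliptic curve,
under the covering `(z, w) ↦ (Φ(z), w ^ k * Ψ(z))`. -/
def coverFiber (R : ℂ[X]) (k : ℕ) (Φ Ψ : RatFunc ℂ) (x y : ℂ) : Set (ℂ × ℂ) :=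
  {P | P.2 ^ 2 = R.eval P.1 ∧ Φ.denom.eval P.1 ≠ 0 ∧
    evalC Φ P.1 = x ∧ P.2 ^ k * evalC Ψ P.1 = y}

/-- The coefficient `h` in `h dz`, the pullback to `G` of the holomorphic differential `dx / y`
under the covering `(z, w) ↦ (Φ(z), w ^ k * Ψ(z))`, at the point `P = (z, w)`. -/
def pullbackCoeff {K : Type} [Field K] [Algebra K ℂ] (k : ℕ) (Φ Ψ : RatFunc K) (P : ℂ × ℂ) : ℂ :=
  deriv (evalC Φ) P.1 / (P.2 ^ k * evalC Ψ P.1)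

/-- The trace of the differential `h dz` on `G` along the covering
`(z, w) ↦ (Φ(z), w ^ k * Ψ(z))` of the elliptic curve `E : y² = 4 x³ - c₂ x - c₃`, divided by
`du = dx / y`, at the point `(x, y)` of `E`. For `h dz = dA` this is the derivative with respect to
`u` of the sum of the values of the abelian integral `A` at the points of `G` over `(x, y)`. -/
def traceCoeff (R : ℂ[X]) (k : ℕ) (Φ Ψ : RatFunc ℂ) (h : ℂ × ℂ → ℂ) (x y : ℂ) : ℂ :=
  ∑ᶠ P ∈ coverFiber R k Φ Ψ x y, h P / pullbackCoeff k Φ Ψ P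

/-- The differential `h dz` on `G` has zero trace on the elliptic curve
`E : y² = 4 x³ - c₂ x - c₃`, i.e. it vanishes on the image of `E` in `Jac(G)` under
`Q ↦ ∑ 𝒜(P)`, the sum running over the points `P` of `G` over `Q`. (Finitely many values of `x`,
such as branch values, are left out.) -/
def VanishesOn (R : ℂ[X]) (c₂ c₃ : ℂ) (k : ℕ) (Φ Ψ : RatFunc ℂ) (h : ℂ × ℂ → ℂ) : Prop :=
  ∀ᶠ x in Filter.cofinite, ∀ y : ℂ, y ^ 2 = 4 * x ^ 3 - c₂ * x - c₃ →
    traceCoeff R k Φ Ψ h x y = 0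

/-- `G : w² = R(z)` is an `N`-fold hyperelliptic tangential covering of the elliptic curve
`E : y² = 4 x³ - g₂ x - g₃`: the image of `E` in `Jac(G)` is tangent at the origin to the image of
`G` under `P ↦ ∫_∞^P (dz / w, z dz / w)`, whose tangent direction is `(0, 1)`; that is, the first
differential `dz / w` vanishes on it. -/
structure IsTangentialCover (R : ℂ[X]) (N : ℕ) (g₂ g₃ : ℂ) (k : ℕ) (Φ Ψ : RatFunc ℂ) :
    Prop where
  cover : IsEllipticCover R N 1 g₂ g₃ k Φ Ψ
  tangent : VanishesOn R g₂ g₃ k Φ Ψ (fun P => 1 / P.2)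

/-- The set of points `(z₁, z₂)` of the real plane on the polhode with parameter `p`, i.e. those
satisfying the generating equation; `Z` is the rational function `z ↦ Z(z)` of the covering of
`W² = -(4 Z³ - G₂ Z - G₃)`. -/
def polhode (G₂ G₃ : ℝ) (Z : RatFunc ℝ) (p : ℝ) : Set (ℝ × ℝ) :=
  {q | Z.denom.eval q.1 ≠ 0 ∧ Z.denom.eval q.2 ≠ 0 ∧
    let Z₁ := Z.eval (RingHom.id ℝ) q.1
    let Z₂ := Z.eval (RingHom.id ℝ) q.2
    16 * (Z₂ - Z₁) ^ 2 * p ^ 2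
      + (16 * G₃ + 8 * G₂ * (Z₁ + Z₂) - 32 * Z₁ * Z₂ * (Z₁ + Z₂)) * p
      + 16 * G₃ * (Z₁ + Z₂) + 8 * G₂ * Z₁ * Z₂ + 16 * Z₁ ^ 2 * Z₂ ^ 2 + G₂ ^ 2 = 0}

/-- The square domain `S = {b₂ ≤ z₁ ≤ b₃, b₄ ≤ z₂ ≤ b₅}`. -/
def squareDomain (b : Fin 5 → ℝ) : Set (ℝ × ℝ) :=
  Set.Icc (b 1) (b 2) ×ˢ Set.Icc (b 3) (b 4)

/-- The real asymmetric part of the polhode: its part in the square domain. -/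
def realAsymmetricPart (b : Fin 5 → ℝ) (G₂ G₃ : ℝ) (Z : RatFunc ℝ) (p : ℝ) : Set (ℝ × ℝ) :=
  polhode G₂ G₃ Z p ∩ squareDomain b

end

/-!
The defining equation of the polhode is the addition relation for `Z₁`, `Z₂` and `p`: up to signs,
points of the curve `y² = 4 x³ - G₂ x - G₃` with these abscissae add up to zero. Put
`f = 4 x³ - G₂ x - G₃`. On the square domain `R ≥ 0`, hence `f(Z) ≤ 0`, so that `Z₁`, `Z₂` and `p`
are abscissae of real points of `y² = -f(x)`. The point is that they all lie on its bounded oval,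
that is, to the right of the smallest real root `e` of `f`; three points of the oval never add up
to zero. The last fact is `addition_relation_ne_zero`: after a translation of the root `e` to the
origin the relation is a sum of nonnegative terms, which vanish together only if `f` has a double
root.

That the values lie on the oval (`least_root_lt`, `eval_mem_oval`) rests on the complementarity.
If `z` runs through one of the two intervals and `Z` reached the other component `(-∞, e]`, then
the minimum of `Z` would be attained at an end or at a critical point of `Z`. At an end `R = 0`, so
`Z` is a root of `f`. The same holds at a critical point provided that the pullback of `dZ / W` is
a constant multiple of `dz / w`, because then `Z' = 0` forces `W = 0`. Thus the minimum would be
`e` itself, and `Z` would be constant nearby, as `f > 0` immediately to the right of `e`.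

The shape of the pullback comes from two steps. For any covering of an elliptic curve by
`w² = R(z)` the pullback of the holomorphic differential is `q dz / w` with a polynomial `q` of
degree at most one (`IsEllipticCover.exists_factorization`). The tangency says that `dz / w` has
zero trace on the first curve, and complementarity says that `q dz / w` has zero trace; if `q`
were not constant, every `r dz / w` with `r` of degree at most one would have zero trace,
contrary to the fact that the pullback of `dx / y` has trace a nonzero multiple of `dx / y`
(`IsTangentialCover.natDegree_eq_zero`).
-/

/-! ### The quintic -/

theorem natDegree_quintic {K : Type} [Field K] [Algebra ℝ K] (b : Fin 5 → ℝ) :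
    (quintic K b).natDegree = 5 := by
  rw [quintic, natDegree_neg, natDegree_finsetProd_X_sub_C_eq_card]
  simp

theorem squarefree_quintic {K : Type} [Field K] [Algebra ℝ K] {b : Fin 5 → ℝ}
    (hb : Function.Injective b) : Squarefree (quintic K b) := by
  have h : (∏ i, (X - C (algebraMap ℝ K (b i)))).Separable :=
    separable_prod_X_sub_C_iff.2 ((algebraMap ℝ K).injective.comp hb)
  rw [quintic]
  exact (Associated.refl _).neg_right.squarefree_iff.1 h.squarefree

/-- A rational function is a polynomial as soon as its square is one after multiplication by a
squarefree polynomial. -/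
theorem exists_polynomial_eq_of_squarefree_mul_sq {K : Type} [Field K] {R g : K[X]}
    (hR : Squarefree R) {t : RatFunc K}
    (h : algebraMap K[X] (RatFunc K) R * t ^ 2 = algebraMap K[X] (RatFunc K) g) :
    ∃ T : K[X], algebraMap K[X] (RatFunc K) T = t := by
  have hd : algebraMap K[X] (RatFunc K) t.denom ≠ 0 :=
    RatFunc.algebraMap_ne_zero t.denom_ne_zero
  have hpoly : R * t.num ^ 2 = g * t.denom ^ 2 := by
    apply RatFunc.algebraMap_injective K
    rw [← RatFunc.num_div_denom t] at h
    simp only [map_mul, map_pow]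
    field_simp at h
    linear_combination h
  have hdvd : t.denom ^ 2 ∣ R :=
    (t.isCoprime_num_denom.symm.pow (m := 2) (n := 2)).dvd_of_dvd_mul_right
      ⟨g, by rw [hpoly, mul_comm]⟩
  have hu : IsUnit t.denom := hR _ (by rwa [← sq])
  have h1 : t.denom = 1 := (RatFunc.monic_denom t).eq_one_of_isUnit hu
  exact ⟨t.num, by rw [← RatFunc.num_div_denom t]; simp [h1]⟩

/-! ### The pullback of the holomorphic differential of an elliptic curve -/

/-- The two partial derivatives of the binary quartic `Q (4 P³ - c₂ P Q² - c₃ Q³)` have no common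
zero when its discriminant does not vanish. -/
theorem isCoprime_partial_derivatives {K : Type} [Field K] [CharZero K] {c₂ c₃ : K}
    (hΔ : c₂ ^ 3 - 27 * c₃ ^ 2 ≠ 0) {P Q : K[X]} (h : IsCoprime P Q) :
    IsCoprime (Q * (12 * P ^ 2 - C c₂ * Q ^ 2))
      (4 * P ^ 3 - 3 * C c₂ * P * Q ^ 2 - 4 * C c₃ * Q ^ 3) := by
  have h4 : IsUnit (4 : K[X]) := by
    have : (4 : K[X]) = C 4 := (map_ofNat C 4).symm
    rw [this]; exact isUnit_C.2 (by norm_num)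
  have h12 : IsUnit (12 : K[X]) := by
    have : (12 : K[X]) = C 12 := (map_ofNat C 12).symm
    rw [this]; exact isUnit_C.2 (by norm_num)
  apply IsCoprime.mul_left
  · have e : 4 * P ^ 3 - 3 * C c₂ * P * Q ^ 2 - 4 * C c₃ * Q ^ 3
        = 4 * P ^ 3 + Q * (- 3 * C c₂ * P * Q - 4 * C c₃ * Q ^ 2) := by ring
    rw [e]
    exact IsCoprime.add_mul_left_right
      ((isCoprime_mul_unit_left_right h4 _ _).2 (h.symm.pow_right)) _
  · have hQ : IsCoprime (12 * P ^ 2 - C c₂ * Q ^ 2) Q := by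
      have e : 12 * P ^ 2 - C c₂ * Q ^ 2 = 12 * P ^ 2 + Q * (- C c₂ * Q) := by ring
      rw [e]
      exact IsCoprime.add_mul_left_left ((isCoprime_mul_unit_left_left h12 _ _).2 h.pow_left) _
    obtain ⟨u, v, huv⟩ := hQ.pow_right (n := 4)
    have hinv : C (c₂ ^ 3 - 27 * c₃ ^ 2)⁻¹ * (C c₂ ^ 3 - 27 * C c₃ ^ 2) = 1 := by
      have : C c₂ ^ 3 - 27 * C c₃ ^ 2 = C (c₂ ^ 3 - 27 * c₃ ^ 2) := by simp [map_ofNat]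
      rw [this, ← C_mul, inv_mul_cancel₀ hΔ, C_1]
    set δ := C (c₂ ^ 3 - 27 * c₃ ^ 2)⁻¹
    set A := C c₂
    set B := C c₃
    have hq : (C (4 : K)⁻¹) * 4 = 1 := by
      have : (4 : K[X]) = C 4 := (map_ofNat C 4).symm
      rw [this, ← C_mul]; simp
    set q := C (4 : K)⁻¹
    -- eliminate `P` from the two forms; the resultant is the discriminant times a power of `Q`
    refine ⟨u + v * δ * (- A ^ 2 * Q ^ 2 + 3 * q * (2 * A * P - 3 * B * Q) * P),
      - v * δ * (9 * q * (2 * A * P - 3 * B * Q)), ?_⟩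
    linear_combination huv + v * Q ^ 4 * hinv +
      v * δ * (3 * (2 * A * P - 3 * B * Q) * Q ^ 2 * (2 * A * P + 3 * B * Q)) * hq

/-- If `T` divides `G = Q (4 P³ - c₂ P Q² - c₃ Q³)` to the second order, then it divides the
Wronskian `P' Q - P Q'`: by Euler's formula `Q G' - 4 Q' G = G_P (P' Q - P Q')` and
`P G' - 4 P' G = -G_Q (P' Q - P Q')`, where `G_P` and `G_Q` are coprime. -/
theorem dvd_wronskian_of_sq_dvd {K : Type} [Field K] [CharZero K] {c₂ c₃ : K}
    (hΔ : c₂ ^ 3 - 27 * c₃ ^ 2 ≠ 0) {P Q T S : K[X]} (h : IsCoprime P Q)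
    (hT : Q * (4 * P ^ 3 - C c₂ * P * Q ^ 2 - C c₃ * Q ^ 3) = T ^ 2 * S) :
    T ∣ derivative P * Q - P * derivative Q := by
  have hT' : derivative Q * (4 * P ^ 3 - C c₂ * P * Q ^ 2 - C c₃ * Q ^ 3) +
      Q * (12 * P ^ 2 * derivative P - C c₂ * (derivative P * Q ^ 2 + 2 * P * Q * derivative Q)
        - 3 * C c₃ * Q ^ 2 * derivative Q) = T * (2 * derivative T * S + T * derivative S) := by
    have := congrArg derivative hT
    simp only [derivative_mul, derivative_sub, derivative_pow, derivative_C, derivative_ofNat,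
      Nat.cast_ofNat, map_ofNat] at this
    linear_combination this
  obtain ⟨u, v, huv⟩ := isCoprime_partial_derivatives hΔ h
  set G' := T * (2 * derivative T * S + T * derivative S) with hG'
  refine ⟨u * (Q * (2 * derivative T * S + T * derivative S) - 4 * derivative Q * (T * S))
    - v * (P * (2 * derivative T * S + T * derivative S) - 4 * derivative P * (T * S)), ?_⟩
  linear_combination (-(derivative P * Q - P * derivative Q)) * huv
    + (u * Q - v * P) * (hT' + hG') + (-4 * u * derivative Q + 4 * v * derivative P) * hT

/-- The algebra behind a covering of `y² = ε (4 x³ - c₂ x - c₃)` by the genus 2 curve `w² = R(z)`,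
given by `x = P / Q` and `y = w ^ (2 m + 1) Ψ`: there is a polynomial `T` with `y = w T / Q²`, and
the pullback of `dx / y` is `q dz / w` with `q` a polynomial of degree at most one, so that
`P' Q - P Q' = q T`. -/
theorem IsEllipticCover.exists_factorization {K : Type} [Field K] [CharZero K] {R : K[X]}
    (hR : Squarefree R) (hR5 : R.natDegree = 5) {N : ℕ} {ε c₂ c₃ : K} (hε : ε ≠ 0) {k : ℕ}
    {Φ Ψ : RatFunc K} (h : IsEllipticCover R N ε c₂ c₃ k Φ Ψ) :
    ∃ (m : ℕ) (T q : K[X]), k = 2 * m + 1 ∧ T ≠ 0 ∧ q ≠ 0 ∧ q.natDegree ≤ 1 ∧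
      R * T ^ 2 = C ε * (Φ.denom *
        (4 * Φ.num ^ 3 - C c₂ * Φ.num * Φ.denom ^ 2 - C c₃ * Φ.denom ^ 3)) ∧
      R ^ m * Φ.denom ^ 2 * Ψ.num = T * Ψ.denom ∧
      derivative Φ.num * Φ.denom - Φ.num * derivative Φ.denom = q * T := by
  obtain ⟨m, hm⟩ := h.odd
  have hR0 : R ≠ 0 := hR.ne_zero
  have hinf := h.infinity
  have heq := h.equation
  have hcop : IsCoprime Φ.num Φ.denom := Φ.isCoprime_num_denom
  have hΦ : algebraMap K[X] (RatFunc K) Φ.num = Φ * algebraMap K[X] (RatFunc K) Φ.denom := by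
    have := RatFunc.num_div_denom Φ
    rwa [div_eq_iff (RatFunc.algebraMap_ne_zero Φ.denom_ne_zero)] at this
  have hQ0 := Φ.denom_ne_zero
  obtain ⟨T, hT⟩ := exists_polynomial_eq_of_squarefree_mul_sq hR
    (t := algebraMap K[X] (RatFunc K) (R ^ m * Φ.denom ^ 2) * Ψ)
    (g := C ε * (Φ.denom *
        (4 * Φ.num ^ 3 - C c₂ * Φ.num * Φ.denom ^ 2 - C c₃ * Φ.denom ^ 3))) (by
      subst hm
      simp only [map_mul, map_pow, map_sub, hΦ, map_ofNat, RatFunc.algebraMap_C]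
      linear_combination (algebraMap K[X] (RatFunc K) Φ.denom) ^ 4 * heq)
  have hg : R * T ^ 2 = C ε * (Φ.denom *
        (4 * Φ.num ^ 3 - C c₂ * Φ.num * Φ.denom ^ 2 - C c₃ * Φ.denom ^ 3)) := by
    apply RatFunc.algebraMap_injective K
    subst hm
    simp only [map_mul, map_pow, map_sub, hΦ, map_ofNat, RatFunc.algebraMap_C, hT]
    linear_combination (algebraMap K[X] (RatFunc K) Φ.denom) ^ 4 * heq
  have hΨ : R ^ m * Φ.denom ^ 2 * Ψ.num = T * Ψ.denom := by
    apply RatFunc.algebraMap_injective K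
    have : algebraMap K[X] (RatFunc K) Ψ.num = Ψ * algebraMap K[X] (RatFunc K) Ψ.denom := by
      have := RatFunc.num_div_denom Ψ
      rwa [div_eq_iff (RatFunc.algebraMap_ne_zero Ψ.denom_ne_zero)] at this
    rw [map_mul, map_mul _ T, hT, this]
    ring
  -- degrees: only `4 P³ Q` has the top degree of `Q (4 P³ - c₂ P Q² - c₃ Q³)`
  set P := Φ.num
  set Q := Φ.denom
  have hP0 : P ≠ 0 := by rintro h0; rw [h0] at hinf; simp at hinf
  have h4 : (4 : K[X]) = C 4 := (map_ofNat C 4).symm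
  have hdF : (4 * P ^ 3 - C c₂ * P * Q ^ 2 - C c₃ * Q ^ 3).natDegree = 3 * P.natDegree := by
    have hd1 : (4 * P ^ 3).natDegree = 3 * P.natDegree := by
      rw [h4, natDegree_C_mul (by norm_num), natDegree_pow]
    have hd2 : (C c₂ * P * Q ^ 2).natDegree ≤ P.natDegree + 2 * Q.natDegree := by
      rw [mul_assoc]
      refine (natDegree_C_mul_le _ _).trans ?_
      exact natDegree_mul_le.trans (by rw [natDegree_pow])
    have hd3 : (C c₃ * Q ^ 3).natDegree ≤ 3 * Q.natDegree := by
      exact (natDegree_C_mul_le _ _).trans (by rw [natDegree_pow])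
    have hd12 : (4 * P ^ 3 - C c₂ * P * Q ^ 2).natDegree = 3 * P.natDegree := by
      rw [natDegree_sub_eq_left_of_natDegree_lt (by omega), hd1]
    rw [natDegree_sub_eq_left_of_natDegree_lt (by omega), hd12]
  have hF0 : 4 * P ^ 3 - C c₂ * P * Q ^ 2 - C c₃ * Q ^ 3 ≠ 0 := by
    intro h0; rw [h0] at hdF; simp at hdF; omega
  have hT0 : T ≠ 0 := by
    rintro rfl
    have := mul_ne_zero (C_ne_zero.2 hε) (mul_ne_zero hQ0 hF0)
    rw [← hg] at this; simp at this
  have hdT : 5 + 2 * T.natDegree = Q.natDegree + 3 * P.natDegree := by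
    have := congrArg natDegree hg
    rwa [natDegree_C_mul hε, natDegree_mul hR0 (pow_ne_zero 2 hT0), natDegree_pow, hR5,
      natDegree_mul hQ0 hF0, hdF] at this
  obtain ⟨q, hq⟩ : T ∣ derivative P * Q - P * derivative Q := by
    apply dvd_wronskian_of_sq_dvd h.nonsingular hcop (S := C ε⁻¹ * R)
    have : C ε⁻¹ * C ε = 1 := by rw [← C_mul, inv_mul_cancel₀ hε, C_1]
    linear_combination (-(Q * (4 * P ^ 3 - C c₂ * P * Q ^ 2 - C c₃ * Q ^ 3))) * this - C ε⁻¹ * hg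
  have hw0 : derivative P * Q - P * derivative Q ≠ 0 := by
    intro h0
    have hdvd : P ∣ derivative P := hcop.dvd_of_dvd_mul_right
      ⟨derivative Q, by linear_combination h0⟩
    have := natDegree_derivative_lt (p := P) (by omega)
    by_cases hP' : derivative P = 0
    · have := derivative_eq_zero.1 hP'
      omega
    · exact absurd (natDegree_le_of_dvd hdvd hP') (by omega)
  have hq0 : q ≠ 0 := by rintro rfl; simp [hw0] at hq
  refine ⟨m, T, q, hm, hT0, hq0, ?_, hg, hΨ, by rw [hq, mul_comm]⟩
  have hdw : (derivative P * Q - P * derivative Q).natDegree ≤ P.natDegree + Q.natDegree - 1 := by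
    apply (natDegree_sub_le _ _).trans
    apply max_le
    · refine natDegree_mul_le.trans ?_
      have := natDegree_derivative_lt (p := P) (by omega)
      omega
    · by_cases hQd : Q.natDegree = 0
      · rw [natDegree_eq_zero] at hQd
        obtain ⟨c, hc⟩ := hQd
        rw [← hc]; simp
      · refine natDegree_mul_le.trans ?_
        have := natDegree_derivative_lt (p := Q) hQd
        omega
  rw [hq, natDegree_mul hT0 hq0] at hdw
  omega

theorem map_quintic (b : Fin 5 → ℝ) :
    (quintic ℝ b).map (algebraMap ℝ ℂ) = quintic ℂ b := by
  simp [quintic, Polynomial.map_prod]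

/-- The value of `y = w ^ (2 m + 1) Ψ(z)` on the curve, in terms of the polynomial `T`. -/
theorem pow_mul_evalC {K : Type} [Field K] [Algebra K ℂ] {R T Q : K[X]} {m : ℕ} {Ψ : RatFunc K}
    (hΨ : R ^ m * Q ^ 2 * Ψ.num = T * Ψ.denom) {z w : ℂ} (hw : w ^ 2 = aeval z R)
    (hQ : aeval z Q ≠ 0) (hd : aeval z Ψ.denom ≠ 0) :
    w ^ (2 * m + 1) * evalC Ψ z = w * aeval z T / aeval z Q ^ 2 := by
  have h := congrArg (aeval z) hΨ
  simp only [map_mul, map_pow] at h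
  have e : evalC Ψ z = aeval z Ψ.num / aeval z Ψ.denom := rfl
  rw [e, pow_succ, pow_mul, hw]
  field_simp
  linear_combination w * h

theorem deriv_evalC {K : Type} [Field K] [Algebra K ℂ] (Φ : RatFunc K) {z : ℂ}
    (hQ : aeval z Φ.denom ≠ 0) :
    deriv (evalC Φ) z =
      aeval z (derivative Φ.num * Φ.denom - Φ.num * derivative Φ.denom) / aeval z Φ.denom ^ 2 := by
  have := ((Φ.num.hasDerivAt_aeval z).div (Φ.denom.hasDerivAt_aeval z) hQ).deriv
  simp only [map_sub, map_mul]
  rw [← this]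
  rfl

/-- The pullback of `dx / y` to the curve `w² = R(z)` is `q dz / w`. -/
theorem pullbackCoeff_eq {K : Type} [Field K] [Algebra K ℂ] {R T q : K[X]} {m : ℕ}
    {Φ Ψ : RatFunc K} (hΨ : R ^ m * Φ.denom ^ 2 * Ψ.num = T * Ψ.denom)
    (hq : derivative Φ.num * Φ.denom - Φ.num * derivative Φ.denom = q * T) {P : ℂ × ℂ}
    (hw : P.2 ^ 2 = aeval P.1 R) (hs : aeval P.1 (R * Φ.denom * Ψ.denom * T) ≠ 0) :
    pullbackCoeff (2 * m + 1) Φ Ψ P = aeval P.1 q / P.2 := by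
  simp only [map_mul, mul_ne_zero_iff] at hs
  obtain ⟨⟨⟨hR, hQ⟩, hd⟩, hT⟩ := hs
  have hw0 : P.2 ≠ 0 := by
    intro h0; rw [h0] at hw; exact hR (by rw [← hw]; simp)
  rw [pullbackCoeff, deriv_evalC Φ hQ, pow_mul_evalC hΨ hw hQ hd, hq, map_mul]
  field_simp

/-! ### Traces on the tangential cover -/

/-- All but finitely many values of a rational function are not taken at any zero of a given
nonzero polynomial. -/
theorem eventually_eval_ne_zero (Φ : RatFunc ℂ) {s : ℂ[X]} (hs : s ≠ 0) :
    ∀ᶠ x in Filter.cofinite, ∀ z, evalC Φ z = x → s.eval z ≠ 0 := by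
  have hfin : {z | s.eval z = 0}.Finite := by
    refine s.roots.toFinset.finite_toSet.subset fun z hz => ?_
    simpa [hs] using hz
  rw [Filter.eventually_cofinite]
  refine (hfin.image (evalC Φ)).subset fun x hx => ?_
  simp only [Set.mem_ofPred_eq, not_forall, not_not] at hx
  obtain ⟨z, hz, h0⟩ := hx
  exact ⟨z, h0, hz⟩

theorem natDegree_num_sub_C_mul_denom {Φ : RatFunc ℂ} (h : Φ.denom.natDegree < Φ.num.natDegree)
    (x : ℂ) : (Φ.num - C x * Φ.denom).natDegree = Φ.num.natDegree :=
  natDegree_sub_eq_left_of_natDegree_lt ((natDegree_C_mul_le _ _).trans_lt h)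

theorem finite_coverFiber (R : ℂ[X]) (k : ℕ) {Φ : RatFunc ℂ} (Ψ : RatFunc ℂ)
    (h : Φ.denom.natDegree < Φ.num.natDegree) (x y : ℂ) : (coverFiber R k Φ Ψ x y).Finite := by
  have hne : Φ.num - C x * Φ.denom ≠ 0 := by
    intro h0
    have := natDegree_num_sub_C_mul_denom h x
    rw [h0] at this; simp at this; omega
  have hsub : coverFiber R k Φ Ψ x y ⊆ ⋃ z ∈ (Φ.num - C x * Φ.denom).roots.toFinset,
      (fun w => (z, w)) '' {w | w ∈ (X ^ 2 - C (R.eval z)).roots.toFinset} := by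
    rintro ⟨z, w⟩ ⟨hw, hQ, hx, -⟩
    simp only [Set.mem_iUnion]
    refine ⟨z, ?_, w, ?_, rfl⟩
    · have hx' : Φ.num.eval z / Φ.denom.eval z = x := hx
      rw [div_eq_iff hQ] at hx'
      simp [hne, hx']
    · have : (X ^ 2 - C (R.eval z) : ℂ[X]) ≠ 0 := X_pow_sub_C_ne_zero (by norm_num) _
      simp only [Set.mem_ofPred_eq, Multiset.mem_toFinset, mem_roots this]
      simp at hw
      simp [hw]
  refine Set.Finite.subset ?_ hsub
  exact (Finset.finite_toSet _).biUnion fun z _ => (Finset.finite_toSet _).image _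

/-- The differentials `q dz / w`, with `q` of degree at most one, whose trace vanishes on a
tangential cover are the multiples of `dz / w`. Otherwise they would span all of these, also the
pullback of `dx / y`; but the trace of the latter is `dx / y` times the degree of the cover. -/
theorem IsTangentialCover.natDegree_eq_zero {R : ℂ[X]} (hR : Squarefree R)
    (hR5 : R.natDegree = 5) {N : ℕ} {g₂ g₃ : ℂ} {k : ℕ} {Φ Ψ : RatFunc ℂ}
    (hE : IsTangentialCover R N g₂ g₃ k Φ Ψ) {q s : ℂ[X]} (hq : q.natDegree ≤ 1) (hs : s ≠ 0)
    {h : ℂ × ℂ → ℂ}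
    (hh : ∀ P : ℂ × ℂ, P.2 ^ 2 = R.eval P.1 → s.eval P.1 ≠ 0 → h P = q.eval P.1 / P.2)
    (hv : VanishesOn R g₂ g₃ k Φ Ψ h) : q.natDegree = 0 := by
  obtain ⟨m, T, r, rfl, hT0, hr0, hr1, hg, hΨ, hr⟩ :=
    hE.cover.exists_factorization hR hR5 one_ne_zero
  have hinf := hE.cover.infinity
  have hbad : R * Φ.denom * Ψ.denom * T * (r * s) ≠ 0 :=
    mul_ne_zero (mul_ne_zero (mul_ne_zero (mul_ne_zero hR.ne_zero Φ.denom_ne_zero)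
      Ψ.denom_ne_zero) hT0) (mul_ne_zero hr0 hs)
  -- a value `x` over which everything is finite and nonzero
  obtain ⟨x, hx₁, hx₂, hx⟩ := (hE.tangent.and (hv.and (eventually_eval_ne_zero Φ hbad))).exists
  obtain ⟨z, hz⟩ : ∃ z, (Φ.num - C x * Φ.denom).eval z = 0 := by
    apply IsAlgClosed.exists_root
    intro h0
    have := natDegree_num_sub_C_mul_denom hinf x
    have := natDegree_eq_zero_iff_degree_le_zero.2 h0.le
    omega
  have hnum : Φ.num.eval z = x * Φ.denom.eval z := by
    simpa [sub_eq_zero] using hz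
  have hQz : Φ.denom.eval z ≠ 0 := by
    intro h0
    obtain ⟨u, v, huv⟩ := Φ.isCoprime_num_denom
    have := congrArg (eval z) huv
    simp [h0, hnum] at this
  have hxz : evalC Φ z = x := by
    change Φ.num.eval z / Φ.denom.eval z = x
    rw [hnum, mul_div_assoc, div_self hQz, mul_one]
  obtain ⟨w, hw⟩ := IsAlgClosed.exists_pow_nat_eq (R.eval z) two_pos
  have hxz' := hx z hxz
  simp only [eval_mul, mul_ne_zero_iff] at hxz'
  set y := w ^ (2 * m + 1) * evalC Ψ z with hy
  have hy2 : y ^ 2 = 4 * x ^ 3 - g₂ * x - g₃ := by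
    rw [hy, pow_mul_evalC hΨ (by rw [coe_aeval_eq_eval, hw]) hQz hxz'.1.1.2]
    have := congrArg (eval z) hg
    simp only [eval_mul, eval_pow, eval_sub, eval_C, eval_ofNat, hnum] at this
    simp only [coe_aeval_eq_eval]
    rw [div_pow, mul_pow, hw, this]
    field_simp
  have hfib := finite_coverFiber R (2 * m + 1) Ψ hinf x y
  have hmem : (z, w) ∈ coverFiber R (2 * m + 1) Φ Ψ x y := ⟨hw, hQz, hxz, rfl⟩
  have hcard : (hfib.toFinset.card : ℂ) ≠ 0 := by
    rw [Nat.cast_ne_zero]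
    exact Finset.card_ne_zero_of_mem (hfib.mem_toFinset.2 hmem)
  have hpt : ∀ P ∈ hfib.toFinset, P.2 ≠ 0 ∧ r.eval P.1 ≠ 0 ∧ h P = q.eval P.1 / P.2 ∧
      pullbackCoeff (2 * m + 1) Φ Ψ P = r.eval P.1 / P.2 := by
    intro P hP
    obtain ⟨hPw, -, hPx, -⟩ := hfib.mem_toFinset.1 hP
    have hPs := hx P.1 hPx
    have hPb : aeval P.1 (R * Φ.denom * Ψ.denom * T) ≠ 0 := by
      rw [eval_mul] at hPs; exact left_ne_zero_of_mul hPs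
    simp only [eval_mul, mul_ne_zero_iff] at hPs
    refine ⟨?_, hPs.2.1, hh P hPw hPs.2.2, pullbackCoeff_eq hΨ hr hPw hPb⟩
    intro h0; rw [h0] at hPw; exact hPs.1.1.1.1 (by rw [← hPw]; simp)
  have s₁ := hx₁ y hy2
  have s₂ := hx₂ y hy2
  rw [traceCoeff, finsum_mem_eq_finite_toFinset_sum _ hfib] at s₁ s₂
  obtain ⟨α, β, rfl⟩ := exists_eq_X_add_C_of_natDegree_le_one hq
  obtain ⟨a, b, rfl⟩ := exists_eq_X_add_C_of_natDegree_le_one hr1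
  have hlin : α * (hfib.toFinset.card : ℂ) = 0 := by
    have : ∑ P ∈ hfib.toFinset, α = ∑ P ∈ hfib.toFinset,
        (a * (h P / pullbackCoeff (2 * m + 1) Φ Ψ P) +
          (α * b - a * β) * (1 / P.2 / pullbackCoeff (2 * m + 1) Φ Ψ P)) := by
      refine Finset.sum_congr rfl fun P hP => ?_
      obtain ⟨h1, h2, h3, h4⟩ := hpt P hP
      rw [h3, h4]
      field_simp
      simp only [eval_add, eval_mul, eval_C, eval_X]
      ring
    rw [Finset.sum_add_distrib, ← Finset.mul_sum, ← Finset.mul_sum, s₁, s₂, Finset.sum_const,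
      nsmul_eq_mul] at this
    linear_combination this
  obtain rfl : α = 0 := (mul_eq_zero.1 hlin).resolve_right hcard
  simp

/-- For the complementary cover `x = Z(z)` the factor `T` of `exists_factorization` is a constant
multiple of the Wronskian: its pulled back differential is a multiple of `dz / w`. In particular
`T` vanishes at the critical points of `Z`. -/
theorem exists_factorization_of_complementary {b : Fin 5 → ℝ} (hb : StrictMono b) {N : ℕ}
    {g₂ g₃ : ℂ} {k₁ : ℕ} {Φ Ψ : RatFunc ℂ} (hE : IsTangentialCover (quintic ℂ b) N g₂ g₃ k₁ Φ Ψ)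
    {G₂ G₃ : ℝ} {k : ℕ} {Z W : RatFunc ℝ} (hE₂ : IsEllipticCover (quintic ℝ b) N (-1) G₂ G₃ k Z W)
    (hcompl : VanishesOn (quintic ℂ b) g₂ g₃ k₁ Φ Ψ (pullbackCoeff k Z W)) :
    ∃ (T : ℝ[X]) (c : ℝ), c ≠ 0 ∧
      quintic ℝ b * T ^ 2 = C (-1) * (Z.denom *
        (4 * Z.num ^ 3 - C G₂ * Z.num * Z.denom ^ 2 - C G₃ * Z.denom ^ 3)) ∧
      derivative Z.num * Z.denom - Z.num * derivative Z.denom = C c * T := by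
  have hR := squarefree_quintic (K := ℝ) hb.injective
  obtain ⟨m, T, q, rfl, hT0, hq0, hq1, hg, hW, hq⟩ :=
    hE₂.exists_factorization hR (natDegree_quintic b) (neg_ne_zero.2 one_ne_zero)
  have hs : quintic ℝ b * Z.denom * W.denom * T ≠ 0 :=
    mul_ne_zero (mul_ne_zero (mul_ne_zero hR.ne_zero Z.denom_ne_zero) W.denom_ne_zero) hT0
  have hev : ∀ (p : ℝ[X]) (z : ℂ), (p.map (algebraMap ℝ ℂ)).eval z = aeval z p := fun p z => by
    rw [eval_map_algebraMap]
  have hdeg := hE.natDegree_eq_zero (squarefree_quintic hb.injective) (natDegree_quintic b)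
    (q := q.map (algebraMap ℝ ℂ))
    (s := (quintic ℝ b * Z.denom * W.denom * T).map (algebraMap ℝ ℂ))
    (by rwa [natDegree_map]) (by rwa [Ne, Polynomial.map_eq_zero])
    (h := pullbackCoeff (2 * m + 1) Z W)
    (fun P hP hs => by
      rw [← map_quintic, hev] at hP
      rw [hev] at hs ⊢
      exact pullbackCoeff_eq hW hq hP hs) hcompl
  rw [natDegree_map, natDegree_eq_zero] at hdeg
  obtain ⟨c, rfl⟩ := hdeg
  exact ⟨T, c, by simpa using hq0, hg, hq⟩

/-! ### Real points of the second elliptic curve -/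

/-- Three abscissae to the right of a root `e` of `4 x³ - G₂ x - G₃` at which this cubic is not
positive never satisfy the addition relation. With `X = x - e` and `4 x³ - G₂ x - G₃ = 4 X h(X)`,
`h(X) = X² + 3 e X + B`, the relation reads
`(X₁ - X₂)² X₃² - 2 X₃ (X₂ h(X₁) + X₁ h(X₂)) + (X₁ X₂ - B)² = 0`, a sum of nonnegative terms. -/
theorem addition_relation_ne_zero {G₂ G₃ e x₁ x₂ p : ℝ} (hΔ : G₂ ^ 3 - 27 * G₃ ^ 2 ≠ 0)
    (he : 4 * e ^ 3 - G₂ * e - G₃ = 0) (h₁ : e < x₁) (h₂ : e < x₂) (hp : e < p)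
    (hf₁ : 4 * x₁ ^ 3 - G₂ * x₁ - G₃ ≤ 0) (hf₂ : 4 * x₂ ^ 3 - G₂ * x₂ - G₃ ≤ 0) :
    16 * (x₂ - x₁) ^ 2 * p ^ 2
      + (16 * G₃ + 8 * G₂ * (x₁ + x₂) - 32 * x₁ * x₂ * (x₁ + x₂)) * p
      + 16 * G₃ * (x₁ + x₂) + 8 * G₂ * x₁ * x₂ + 16 * x₁ ^ 2 * x₂ ^ 2 + G₂ ^ 2 ≠ 0 := by
  obtain rfl : G₃ = 4 * e ^ 3 - G₂ * e := by linarith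
  obtain ⟨X₁, rfl⟩ : ∃ X, x₁ = X + e := ⟨x₁ - e, by ring⟩
  obtain ⟨X₂, rfl⟩ : ∃ X, x₂ = X + e := ⟨x₂ - e, by ring⟩
  obtain ⟨X₃, rfl⟩ : ∃ X, p = X + e := ⟨p - e, by ring⟩
  obtain ⟨B, rfl⟩ : ∃ B, G₂ = 4 * (3 * e ^ 2 - B) := ⟨3 * e ^ 2 - G₂ / 4, by ring⟩
  have p₁ : 0 < X₁ := by linarith
  have p₂ : 0 < X₂ := by linarith
  have p₃ : 0 < X₃ := by linarith
  have n₁ : X₁ ^ 2 + 3 * e * X₁ + B ≤ 0 := by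
    by_contra! h; nlinarith [mul_pos p₁ h]
  have n₂ : X₂ ^ 2 + 3 * e * X₂ + B ≤ 0 := by
    by_contra! h; nlinarith [mul_pos p₂ h]
  intro h
  have key : ((X₁ - X₂) * X₃) ^ 2 + 2 * X₃ * (X₂ * -(X₁ ^ 2 + 3 * e * X₁ + B)) +
      2 * X₃ * (X₁ * -(X₂ ^ 2 + 3 * e * X₂ + B)) + (X₁ * X₂ - B) ^ 2 = 0 := by
    linear_combination h / 16
  have t₁ : 0 ≤ 2 * X₃ * (X₂ * -(X₁ ^ 2 + 3 * e * X₁ + B)) :=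
    mul_nonneg (by positivity) (mul_nonneg p₂.le (by linarith))
  have t₂ : 0 ≤ 2 * X₃ * (X₁ * -(X₂ ^ 2 + 3 * e * X₂ + B)) :=
    mul_nonneg (by positivity) (mul_nonneg p₁.le (by linarith))
  have t₃ := sq_nonneg ((X₁ - X₂) * X₃)
  have t₄ := sq_nonneg (X₁ * X₂ - B)
  have z₁ : 2 * X₃ * (X₂ * -(X₁ ^ 2 + 3 * e * X₁ + B)) = 0 := by linarith
  have z₃ : ((X₁ - X₂) * X₃) ^ 2 = 0 := by linarith
  have z₄ : (X₁ * X₂ - B) ^ 2 = 0 := by linarith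
  obtain rfl : X₁ = X₂ := by
    have := (mul_eq_zero.1 (pow_eq_zero_iff (two_ne_zero) |>.1 z₃)).resolve_right p₃.ne'
    linarith
  have hB : B = X₁ ^ 2 := by
    have := pow_eq_zero_iff (two_ne_zero) |>.1 z₄
    linarith
  have hh : X₁ ^ 2 + 3 * e * X₁ + B = 0 := by
    have := (mul_eq_zero.1 ((mul_eq_zero.1 z₁).resolve_left (by positivity))).resolve_left p₂.ne'
    linarith
  have hX : 3 * e = -2 * X₁ := by
    apply mul_right_cancel₀ p₁.ne'
    linear_combination hh - hB
  have hX' : X₁ = -3 / 2 * e := by linarith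
  -- `h` has a double root, so the discriminant vanishes
  apply hΔ
  rw [hB, hX']; ring

/-- To the right of its smallest real root, a cubic without double roots is positive. -/
theorem derivative_pos_at_least_root {G₂ G₃ e : ℝ} (hΔ : G₂ ^ 3 - 27 * G₃ ^ 2 ≠ 0)
    (he : 4 * e ^ 3 - G₂ * e - G₃ = 0)
    (hmin : ∀ x, 4 * x ^ 3 - G₂ * x - G₃ = 0 → e ≤ x) : 0 < 12 * e ^ 2 - G₂ := by
  obtain rfl : G₃ = 4 * e ^ 3 - G₂ * e := by linarith
  by_contra! h
  have hne : 12 * e ^ 2 - G₂ ≠ 0 := by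
    intro h0
    obtain rfl : G₂ = 12 * e ^ 2 := by linarith
    exact hΔ (by ring)
  have hlt := lt_of_le_of_ne h hne
  have hs0 : 0 ≤ G₂ - 3 * e ^ 2 := by nlinarith [sq_nonneg e]
  have hs := Real.sq_sqrt hs0
  have hsn := Real.sqrt_nonneg (G₂ - 3 * e ^ 2)
  set s := Real.sqrt (G₂ - 3 * e ^ 2)
  -- the smaller of the two other roots
  have := hmin ((-e - s) / 2) (by linear_combination (-(3 * e + s) / 2) * hs)
  nlinarith

/-- Let `e` be the smallest root of `f = 4 x³ - G₂ x - G₃`, and let `F` be a continuous function on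
`[u, v]` with `f ∘ F ≤ 0`, which takes the value `e` only finitely often, and whose values at the
ends and at the interior critical points are roots of `f`. Then `F > e`: the minimum of `F` is a
root, and if it were `e` then `F` would be constant near it, because `f` is positive immediately to
the right of `e`. -/
theorem least_root_lt {G₂ G₃ e u v : ℝ} (hΔ : G₂ ^ 3 - 27 * G₃ ^ 2 ≠ 0)
    (he : 4 * e ^ 3 - G₂ * e - G₃ = 0)
    (hmin : ∀ x, 4 * x ^ 3 - G₂ * x - G₃ = 0 → e ≤ x) (huv : u < v) {F : ℝ → ℝ}
    (hF : ContinuousOn F (Set.Icc u v))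
    (hf : ∀ z ∈ Set.Icc u v, 4 * F z ^ 3 - G₂ * F z - G₃ ≤ 0)
    (hu : 4 * F u ^ 3 - G₂ * F u - G₃ = 0) (hv : 4 * F v ^ 3 - G₂ * F v - G₃ = 0)
    (hcrit : ∀ z ∈ Set.Ioo u v, deriv F z = 0 → 4 * F z ^ 3 - G₂ * F z - G₃ = 0)
    (hfin : {z | z ∈ Set.Icc u v ∧ F z = e}.Finite) :
    ∀ z ∈ Set.Icc u v, e < F z := by
  obtain ⟨a, ha, hamin⟩ := isCompact_Icc.exists_isMinOn (Set.nonempty_Icc.2 huv.le) hF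
  have haroot : 4 * F a ^ 3 - G₂ * F a - G₃ = 0 := by
    rcases eq_or_lt_of_le ha.1 with rfl | h1
    · exact hu
    rcases eq_or_lt_of_le ha.2 with rfl | h2
    · exact hv
    · exact hcrit a ⟨h1, h2⟩ (hamin.isLocalMin (Icc_mem_nhds h1 h2)).deriv_eq_zero
  rcases eq_or_lt_of_le (hmin _ haroot) with hea | hlt
  swap
  · exact fun z hz => hlt.trans_le (hamin hz)
  exfalso
  have hd := derivative_pos_at_least_root hΔ he hmin
  -- `f(x) = (x - e) (4 x² + 4 e x + 4 e² - G₂)`, with the second factor positive near `e`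
  have hpos : ∀ᶠ z in nhdsWithin a (Set.Icc u v),
      0 < 4 * F z ^ 2 + 4 * e * F z + 4 * e ^ 2 - G₂ := by
    have hc : ContinuousWithinAt (fun z => 4 * F z ^ 2 + 4 * e * F z + 4 * e ^ 2 - G₂)
        (Set.Icc u v) a := by
      have := hF a ha
      fun_prop
    refine hc.eventually (lt_mem_nhds ?_)
    change 0 < 4 * F a ^ 2 + 4 * e * F a + 4 * e ^ 2 - G₂
    rw [← hea]; linarith
  have hconst : ∀ᶠ z in nhdsWithin a (Set.Icc u v), z ∈ {z | z ∈ Set.Icc u v ∧ F z = e} := by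
    filter_upwards [hpos, self_mem_nhdsWithin] with z hz hzm
    refine ⟨hzm, le_antisymm ?_ (hea.trans_le (hamin hzm))⟩
    by_contra! hgt
    have := mul_pos (sub_pos.2 hgt) hz
    have := hf z hzm
    nlinarith
  have hinf : {z | z ∈ Set.Icc u v ∧ F z = e}.Infinite := by
    have hne : (nhdsWithin a (Set.Icc u v \ {a})).NeBot := by
      have hcl : a ∈ closure (Set.Icc u v \ {a}) := by
        rcases eq_or_lt_of_le ha.1 with rfl | h1
        · have : Set.Ioo u v ⊆ Set.Icc u v \ {u} := fun z hz => ⟨⟨hz.1.le, hz.2.le⟩, hz.1.ne'⟩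
          apply closure_mono this
          rw [closure_Ioo huv.ne]; exact ha
        · have : Set.Ioo u a ⊆ Set.Icc u v \ {a} :=
            fun z hz => ⟨⟨hz.1.le, hz.2.le.trans ha.2⟩, hz.2.ne⟩
          apply closure_mono this
          rw [closure_Ioo h1.ne]; exact ⟨h1.le, le_rfl⟩
      exact mem_closure_iff_nhdsWithin_neBot.1 hcl
    intro hfin
    have h1 : ∀ᶠ z in nhdsWithin a (Set.Icc u v \ {a}), z ∈ {z | z ∈ Set.Icc u v ∧ F z = e} :=
      hconst.filter_mono (nhdsWithin_mono _ Set.sdiff_subset)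
    have h2 : ∀ᶠ z in nhdsWithin a (Set.Icc u v \ {a}),
        z ∉ {z | z ∈ Set.Icc u v ∧ F z = e} \ {a} :=
      (hfin.subset Set.sdiff_subset).isClosed.isOpen_compl.mem_nhds (by simp)
        |> mem_nhdsWithin_of_mem_nhds
    have h3 : ∀ᶠ z in nhdsWithin a (Set.Icc u v \ {a}), z ∈ Set.Icc u v \ {a} :=
      self_mem_nhdsWithin
    obtain ⟨z, hz1, hz2, hz3⟩ := (h1.and (h2.and h3)).exists
    exact hz2 ⟨hz1, hz3.2⟩
  exact hinf hfin

/-- The value of `f = 4 x³ - G₂ x - G₃` at `Z = P / Q`, from `R T² = -Q (4 P³ - G₂ P Q² - G₃ Q³)`. -/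
theorem cubic_eval_eq {R : ℝ[X]} {G₂ G₃ : ℝ} {Z : RatFunc ℝ} {T : ℝ[X]}
    (hg : R * T ^ 2 = C (-1) * (Z.denom *
      (4 * Z.num ^ 3 - C G₂ * Z.num * Z.denom ^ 2 - C G₃ * Z.denom ^ 3)))
    {z : ℝ} (h0 : Z.denom.eval z ≠ 0) :
    4 * Z.eval (RingHom.id ℝ) z ^ 3 - G₂ * Z.eval (RingHom.id ℝ) z - G₃ =
      -(R.eval z * T.eval z ^ 2) / Z.denom.eval z ^ 4 := by
  have hZ : Z.eval (RingHom.id ℝ) z = Z.num.eval z / Z.denom.eval z := rfl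
  have := congrArg (eval z) hg
  simp only [eval_mul, eval_pow, eval_sub, eval_C, eval_ofNat] at this
  rw [hZ, this]
  field_simp

/-- On a real interval that ends in branch points, where `R ≥ 0` and `Z` is finite, the values of
`Z` lie to the right of the smallest root of `4 x³ - G₂ x - G₃`, and this cubic is not positive at
them. -/
theorem eval_mem_oval {R : ℝ[X]} {G₂ G₃ c : ℝ} {Z : RatFunc ℝ} {T : ℝ[X]}
    (hΔ : G₂ ^ 3 - 27 * G₃ ^ 2 ≠ 0) (hinf : Z.denom.natDegree < Z.num.natDegree)
    (hc : c ≠ 0)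
    (hg : R * T ^ 2 = C (-1) * (Z.denom *
      (4 * Z.num ^ 3 - C G₂ * Z.num * Z.denom ^ 2 - C G₃ * Z.denom ^ 3)))
    (hq : derivative Z.num * Z.denom - Z.num * derivative Z.denom = C c * T)
    {e u v : ℝ} (he : 4 * e ^ 3 - G₂ * e - G₃ = 0)
    (hmin : ∀ x, 4 * x ^ 3 - G₂ * x - G₃ = 0 → e ≤ x) (huv : u < v)
    (hu : R.eval u = 0) (hv : R.eval v = 0) (hpos : ∀ z ∈ Set.Icc u v, 0 ≤ R.eval z)
    (hfin : ∀ z ∈ Set.Icc u v, Z.denom.eval z ≠ 0) {z : ℝ} (hz : z ∈ Set.Icc u v) :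
    4 * Z.eval (RingHom.id ℝ) z ^ 3 - G₂ * Z.eval (RingHom.id ℝ) z - G₃ ≤ 0 ∧
      e < Z.eval (RingHom.id ℝ) z := by
  have hle : ∀ z ∈ Set.Icc u v,
      4 * Z.eval (RingHom.id ℝ) z ^ 3 - G₂ * Z.eval (RingHom.id ℝ) z - G₃ ≤ 0 := by
    intro z hz
    rw [cubic_eval_eq hg (hfin z hz)]
    have := mul_nonneg (hpos z hz) (sq_nonneg (T.eval z))
    exact div_nonpos_of_nonpos_of_nonneg (by linarith) (by positivity)
  refine ⟨hle z hz, ?_⟩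
  have hne : Z.num - C e * Z.denom ≠ 0 := by
    intro h0
    have : (Z.num - C e * Z.denom).natDegree = Z.num.natDegree :=
      natDegree_sub_eq_left_of_natDegree_lt ((natDegree_C_mul_le _ _).trans_lt hinf)
    rw [h0] at this; simp at this; omega
  refine least_root_lt hΔ he hmin huv (F := fun z => Z.eval (RingHom.id ℝ) z) ?_ hle
    ?_ ?_ ?_ ?_ z hz
  · exact Z.num.continuous.continuousOn.div Z.denom.continuous.continuousOn hfin
  · simp only [cubic_eval_eq hg (hfin u <| Set.left_mem_Icc.2 huv.le), hu]; simp
  · simp only [cubic_eval_eq hg (hfin v <| Set.right_mem_Icc.2 huv.le), hv]; simp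
  · intro z hz hd
    have hz' := Set.Ioo_subset_Icc_self hz
    have hQ := hfin z hz'
    have hder := ((Z.num.hasDerivAt z).div (Z.denom.hasDerivAt z) hQ).deriv
    have hd' : ((derivative Z.num).eval z * Z.denom.eval z
        - Z.num.eval z * (derivative Z.denom).eval z) / Z.denom.eval z ^ 2 = 0 := by
      rw [← hder]; exact hd
    rw [div_eq_zero_iff, or_iff_left (pow_ne_zero 2 hQ)] at hd'
    have hT : T.eval z = 0 := by
      have := congrArg (eval z) hq
      simp only [eval_sub, eval_mul, eval_C] at this
      rw [hd'] at this
      exact (mul_eq_zero.1 this.symm).resolve_left hc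
    simp only [cubic_eval_eq hg hQ, hT]; simp
  · refine (Z.num - C e * Z.denom).roots.toFinset.finite_toSet.subset ?_
    rintro z ⟨hz, hze⟩
    have hze' : Z.num.eval z / Z.denom.eval z = e := hze
    rw [div_eq_iff (hfin z hz)] at hze'
    simp [hne, hze']

theorem exists_least_root {G₂ G₃ x : ℝ} (hx : 4 * x ^ 3 - G₂ * x - G₃ = 0) :
    ∃ e : ℝ, 4 * e ^ 3 - G₂ * e - G₃ = 0 ∧ ∀ x, 4 * x ^ 3 - G₂ * x - G₃ = 0 → e ≤ x := by
  have hne : (C 4 * X ^ 3 - C G₂ * X - C G₃ : ℝ[X]) ≠ 0 := by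
    intro h0
    have := congrArg (fun p => coeff p 3) h0
    simp at this
  have hfin : {x : ℝ | 4 * x ^ 3 - G₂ * x - G₃ = 0}.Finite := by
    refine (C 4 * X ^ 3 - C G₂ * X - C G₃ : ℝ[X]).roots.toFinset.finite_toSet.subset fun y hy => ?_
    rw [Finset.mem_coe, Multiset.mem_toFinset, mem_roots hne]
    simpa using hy
  obtain ⟨e, he, hmin⟩ := Set.exists_min_image _ id hfin ⟨x, hx⟩
  exact ⟨e, he, hmin⟩

/-! ### The polhode -/

theorem eval_quintic (b : Fin 5 → ℝ) (z : ℝ) : (quintic ℝ b).eval z =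
    -((z - b 0) * (z - b 1) * (z - b 2) * (z - b 3) * (z - b 4)) := by
  simp [quintic, Fin.prod_univ_five]

theorem mainTheorem4
    -- the curve `G : w² = -∏ (z - b_k)` with real branch points
    (b : Fin 5 → ℝ) (hb : StrictMono b)
    -- `G` is an `N`-fold tangential covering of `y² = 4 x³ - g₂ x - g₃`
    (N : ℕ) (g₂ g₃ : ℂ) (k₁ : ℕ) (Φ Ψ : RatFunc ℂ)
    (hE : IsTangentialCover (quintic ℂ b) N g₂ g₃ k₁ Φ Ψ)
    -- the second covering `Z = Z(z)`, `W = w ^ k * W(z)`, of `W² = -(4 Z³ - G₂ Z - G₃)`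
    (G₂ G₃ : ℝ) (k : ℕ) (Z W : RatFunc ℝ)
    (hE₂ : IsEllipticCover (quintic ℝ b) N (-1) G₂ G₃ k Z W)
    -- it is complementary to the first one: the pullback of `dZ / W` vanishes on the first curve
    (hcompl : VanishesOn (quintic ℂ b) g₂ g₃ k₁ Φ Ψ (pullbackCoeff k Z W))
    -- `Z(z₁)` and `Z(z₂)` are finite on the square domain
    (hfin : ∀ q ∈ squareDomain b, Z.denom.eval q.1 ≠ 0 ∧ Z.denom.eval q.2 ≠ 0)
    -- the real parameter `p = ℘̃(U_*)` equals `Z(z₁)` or `Z(z₂)` somewhere in the square domain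
    (p : ℝ)
    (hp : ∃ q ∈ squareDomain b,
      p = Z.eval (RingHom.id ℝ) q.1 ∨ p = Z.eval (RingHom.id ℝ) q.2) :
    realAsymmetricPart b G₂ G₃ Z p = ∅ := by
  obtain ⟨T, c, hc, hg, hq⟩ := exists_factorization_of_complementary hb hE hE₂ hcompl
  have h01 : b 0 < b 1 := hb (by decide)
  have h12 : b 1 < b 2 := hb (by decide)
  have h23 : b 2 < b 3 := hb (by decide)
  have h34 : b 3 < b 4 := hb (by decide)
  have hfin₁ : ∀ z ∈ Set.Icc (b 1) (b 2), Z.denom.eval z ≠ 0 := fun z hz =>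
    (hfin (z, b 3) ⟨hz, Set.left_mem_Icc.2 h34.le⟩).1
  have hfin₂ : ∀ z ∈ Set.Icc (b 3) (b 4), Z.denom.eval z ≠ 0 := fun z hz =>
    (hfin (b 1, z) ⟨Set.left_mem_Icc.2 h12.le, hz⟩).2
  -- the value of `Z` at a branch point is a root of the cubic, which therefore has a smallest root
  obtain ⟨e, he, hmin⟩ : ∃ e : ℝ, 4 * e ^ 3 - G₂ * e - G₃ = 0 ∧
      ∀ x, 4 * x ^ 3 - G₂ * x - G₃ = 0 → e ≤ x := by
    have hQ := hfin₁ (b 1) (Set.left_mem_Icc.2 h12.le)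
    refine exists_least_root (x := Z.eval (RingHom.id ℝ) (b 1)) ?_
    rw [cubic_eval_eq hg hQ, eval_quintic]
    simp
  have h₁ : ∀ z ∈ Set.Icc (b 1) (b 2), _ := fun z hz =>
    eval_mem_oval hE₂.nonsingular hE₂.infinity hc hg hq he hmin h12 (by simp [eval_quintic])
      (by simp [eval_quintic]) (fun x hx => by
        have a0 : 0 ≤ x - b 0 := by linarith [hx.1]
        have a1 : 0 ≤ x - b 1 := by linarith [hx.1]
        have a2 : 0 ≤ b 2 - x := by linarith [hx.2]
        have a3 : 0 ≤ b 3 - x := by linarith [hx.2]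
        have a4 : 0 ≤ b 4 - x := by linarith [hx.2]
        rw [eval_quintic]
        have : 0 ≤ (x - b 0) * (x - b 1) * (b 2 - x) * (b 3 - x) * (b 4 - x) := by positivity
        linarith) hfin₁ hz
  have h₂ : ∀ z ∈ Set.Icc (b 3) (b 4), _ := fun z hz =>
    eval_mem_oval hE₂.nonsingular hE₂.infinity hc hg hq he hmin h34 (by simp [eval_quintic])
      (by simp [eval_quintic]) (fun x hx => by
        have a0 : 0 ≤ x - b 0 := by linarith [hx.1]
        have a1 : 0 ≤ x - b 1 := by linarith [hx.1]
        have a2 : 0 ≤ x - b 2 := by linarith [hx.1]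
        have a3 : 0 ≤ x - b 3 := by linarith [hx.1]
        have a4 : 0 ≤ b 4 - x := by linarith [hx.2]
        rw [eval_quintic]
        have : 0 ≤ (x - b 0) * (x - b 1) * (x - b 2) * (x - b 3) * (b 4 - x) := by positivity
        linarith) hfin₂ hz
  have hpe : e < p := by
    obtain ⟨q, ⟨hq₁, hq₂⟩, rfl | rfl⟩ := hp
    · exact (h₁ _ hq₁).2
    · exact (h₂ _ hq₂).2
  rw [Set.eq_empty_iff_forall_notMem]
  rintro q ⟨⟨-, -, hpol⟩, hq₁, hq₂⟩
  exact addition_relation_ne_zero hE₂.nonsingular he (h₁ _ hq₁).2 (h₂ _ hq₂).2 hpe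
    (h₁ _ hq₁).1 (h₂ _ hq₂).1 hpol
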